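/- **Field inversion and type member inversion (cDOT).** Fix disjoint sets of variables $x$, term members $a$ and type members $A$. Paths are $p,q ::= x \mid p.a$. Types, identified up to renaming of bound variables, are $$S,T,U ::= \top \mid \bot \mid \{a:T\} \mid \{A:S..T\} \mid S\wedge T \mid \mu(x:T) \mid \forall(x:S)T \mid p.A \mid p.\mathsf{type}.$$ An environment $\Gamma$ is a finite list of bindings $x:T$ of distinct variables. Write $T[p\mapsto q]$ for any type obtained from $T$ by replacing one occurrence of the path $p$ (possibly as a prefix of a longer path) by $q$; several occurrences are replaced in several steps. *Precise typing of paths.* $\Gamma\vdash_! p:T$ is generated by: $\Gamma\vdash_! x:\Gamma(x)$; if $\Gamma\vdash_! p:\{a:T\}$ then $\Gamma\vdash_! p.a:T$; if $\Gamma\vdash_! p:\mu(x:T)$ then $\Gamma\vdash_! p:T[p/x]$; if $\Gamma\vdash_! p:T\wedge U$ then $\Gamma\vdash_! p:T$ and $\Gamma\vdash_! p:U$. $\Gamma\vdash_{!!}p:T$ is generated by: if $\Gamma\vdash_! p:T$ then $\Gamma\vdash_{!!}p:T$; if $\Gamma\vdash_{!!}p:q.\mathsf{type}$ and $\Gamma\vdash_{!!}q.a:T$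 then $\Gamma\vdash_{!!}p.a:q.a.\mathsf{type}$. $\Gamma\vdash_{!!!}p:T$ is generated by: if $\Gamma\vdash_{!!}p:T$ then $\Gamma\vdash_{!!!}p:T$; if $\Gamma\vdash_{!!}p:q.\mathsf{type}$ and $\Gamma\vdash_{!!!}q:T$ then $\Gamma\vdash_{!!!}p:T$. *Tight subtyping* $\Gamma\vdash_\# S<:T$ is the least reflexive and transitive relation such that - $T<:\top$, $\ \bot<:T$, $\ T\wedge U<:T$, $\ T\wedge U<:U$; if $S<:T$ and $S<:U$ then $S<:T\wedge U$; - if $\Gamma\vdash_{!!!}p:\{A:S..S\}$ then $S<:p.A$ and $p.A<:S$; - if $\Gamma\vdash_{!!!}p:q.\mathsf{type}$ and $\Gamma\vdash_{!!}q:Q$ for some $Q$, then $T<:T[p\mapsto q]$ and $T<:T[q\mapsto p]$; - if $T<:U$ then $\{a:T\}<:\{a:U\}$; if $S_2<:S_1$ and $T_1<:T_2$ then $\{A:S_1..T_1\}<:\{A:S_2..T_2\}$; - if $\Gamma\vdash_\# S_2<:S_1$ and $\Gamma,x:S_2\vdash T_1<:T_2$ in the general subtyping relation of cDOT, then $\forall(x:S_1)T_1<:\forall(x:S_2)T_2$.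 (General subtyping and general typing of cDOT are defined by mutual recursion; they enter only through the last rule. General subtyping has the same rules with $\vdash$ for $\vdash_\#$, with $\Gamma\vdash p:\{A:S..T\}$ giving $S<:p.A$ and $p.A<:T$ in the third group, with premises $\Gamma\vdash p:q.\mathsf{type}$ and $\Gamma\vdash q:Q$ in the fourth, and with the three additional inversion rules: if $U\searrow\{a:T_1\}$ and $\Gamma\vdash U<:\{a:T_2\}$ then $\Gamma\vdash T_1<:T_2$; if $U\searrow\{A:S_1..T_1\}$ and $\Gamma\vdash U<:\{A:S_2..T_2\}$ then $\Gamma\vdash S_2<:S_1$ and $\Gamma\vdash T_1<:T_2$. The general types of paths are generated by: $\Gamma\vdash x:\Gamma(x)$; $p:\{a:T\}$ if and only if $p.a:T$; $p:\mu(x:T)$ if and only if $p:T[p/x]$; if $p:T$ and $p:U$ then $p:T\wedge U$; if $p:T$ then $p:p.\mathsf{type}$; if $p:q.\mathsf{type}$ and $q:T$ then $p:T$; if $p:q.\mathsf{type}$ and $q.a:T$ then $p.a:q.a.\mathsf{type}$; if $p:T$ and $\Gamma\vdash T<:U$ then $p:U$.) *Unique membership.* $T\searrow U$ means $T\searrow_{L}U$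 for some set of labels $L$, where $\{A:S..T\}\searrow_{\{A\}}\{A:S..T\}$, $\ \{a:T\}\searrow_{\{a\}}\{a:T\}$, $\ \mu(x:T)\searrow_{\varnothing}\mu(x:T)$, and if $U_1\searrow_{L_1}T_1$, $U_2\searrow_{L_2}T_2$ and $L_1\cap L_2=\varnothing$, then $U_1\wedge U_2\searrow_{L_1\cup L_2}T_1$ and $U_1\wedge U_2\searrow_{L_1\cup L_2}T_2$. *Inertness.* A type is inert if it is a function type $\forall(x:S)T$ or a type $\mu(x:R)$ with $R$ a record, where a record is an intersection, with pairwise distinct labels, of one or more types of the forms $\{A:T..T\}$, $\{a:q.\mathsf{type}\}$, and $\{a:T\}$ with $T$ inert. An environment is inert if all its types are inert. **Statement.** Let $\Gamma$ be an inert environment and $U$ a type. 1. For all $a,T_1,T_2$: if $\Gamma\vdash_\# U<:\{a:T_2\}$ and $U\searrow\{a:T_1\}$, then $\Gamma\vdash_\# T_1<:T_2$. 2. For all $A,S_1,T_1,S_2,T_2$: if $\Gamma\vdash_\# U<:\{A:S_2..T_2\}$ and $U\searrow\{A:S_1..T_1\}$, then $\Gamma\vdash_\# S_2<:S_1$ and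 $\Gamma\vdash_\# T_1<:T_2$. -/

import Mathlib

/-! The calculus cDOT: syntax, typing, subtyping, the precise (elimination) typing levels for
paths, tight subtyping and inert environments.

Variables are de Bruijn indices, so syntactic equality is equality up to renaming of bound
variables.  Term members `a` and type members `A` are two separate sorts of labels. -/

namespace CDOT

/-- Names of term members (fields). -/
abbrev TrmName := ℕ

/-- Names of type members. -/
abbrev TypName := ℕ

/-- Labels of either sort: a term member and a type member never coincide. -/
inductive Label where
  | trm (a : TrmName)
  | typ (A : TypName)

/-- Paths `p ::= x | p.a`. -/
inductive Path where
  | var (x : ℕ)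
  | sel (p : Path) (a : TrmName)

/-- Types. `mu` and the second argument of `all` bind one variable. -/
inductive Typ where
  /-- the top type -/
  | top
  /-- the bottom type -/
  | bot
  /-- field declaration `{a : T}` -/
  | fld (a : TrmName) (T : Typ)
  /-- type declaration `{A : S..T}` -/
  | mem (A : TypName) (S T : Typ)
  /-- intersection `S ∧ T` -/
  | and (S T : Typ)
  /-- recursive type `μ(x : T)` -/
  | mu (T : Typ)
  /-- dependent function type `∀(x : S) T` -/
  | all (S T : Typ)
  /-- type projection `p.A` -/
  | proj (p : Path) (A : TypName)
  /-- singleton type `p.type` -/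
  | sngl (p : Path)

mutual
/-- Terms. -/
inductive Trm where
  /-- stable term -/
  | stable (s : Stable)
  /-- application `p q` -/
  | app (p q : Path)
  /-- `let x = t in u`, with `x` bound in `u` -/
  | letIn (t u : Trm)
  /-- `case p of y : q.A => t₁ else t₂`, with `y` bound in `t₁` -/
  | caseOf (p q : Path) (A : TypName) (t₁ t₂ : Trm)
/-- Stable terms: paths and values. -/
inductive Stable where
  | path (p : Path)
  | val (v : Val)
/-- Values. -/
inductive Val where
  /-- tagged object `ν(x : T)[q.A] d`, with `x` bound in `T`, in `q` and in `d` -/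
  | obj (q : Path) (A : TypName) (T : Typ) (d : Defn)
  /-- `λ(x : T) t`, with `x` bound in `t` -/
  | lam (T : Typ) (t : Trm)
/-- Definitions (object bodies). -/
inductive Defn where
  /-- field definition `{a = s}` -/
  | fld (a : TrmName) (s : Stable)
  /-- type definition `{A = T}` -/
  | typ (A : TypName) (T : Typ)
  /-- aggregate definition `d₁ ∧ d₂` -/
  | and (d₁ d₂ : Defn)
end

/-! ### Substitution of paths for variables -/

/-- Simultaneous substitution; `(x.a.b)[p/x] = p.a.b`. -/
def Path.subst (σ : ℕ → Path) : Path → Path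
  | .var x => σ x
  | .sel p a => .sel (p.subst σ) a

/-- Weakening by one variable. -/
def Path.shift (p : Path) : Path := p.subst fun n => .var (n + 1)

/-- The substitution `σ` under a binder. -/
def up (σ : ℕ → Path) : ℕ → Path
  | 0 => .var 0
  | n + 1 => (σ n).shift

/-- The substitution that puts `p` for the most recently bound variable. -/
def single (p : Path) : ℕ → Path
  | 0 => p
  | n + 1 => .var n

def Typ.subst (σ : ℕ → Path) : Typ → Typ
  | .top => .top
  | .bot => .bot
  | .fld a T => .fld a (T.subst σ)
  | .mem A S T => .mem A (S.subst σ) (T.subst σ)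
  | .and S T => .and (S.subst σ) (T.subst σ)
  | .mu T => .mu (T.subst (up σ))
  | .all S T => .all (S.subst σ) (T.subst (up σ))
  | .proj p A => .proj (p.subst σ) A
  | .sngl p => .sngl (p.subst σ)

mutual
def Trm.subst (σ : ℕ → Path) : Trm → Trm
  | .stable s => .stable (s.subst σ)
  | .app p q => .app (p.subst σ) (q.subst σ)
  | .letIn t u => .letIn (t.subst σ) (u.subst (up σ))
  | .caseOf p q A t₁ t₂ =>
      .caseOf (p.subst σ) (q.subst σ) A (t₁.subst (up σ)) (t₂.subst σ)
def Stable.subst (σ : ℕ → Path) : Stable → Stable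
  | .path p => .path (p.subst σ)
  | .val v => .val (v.subst σ)
def Val.subst (σ : ℕ → Path) : Val → Val
  | .obj q A T d => .obj (q.subst (up σ)) A (T.subst (up σ)) (d.subst (up σ))
  | .lam T t => .lam (T.subst σ) (t.subst (up σ))
def Defn.subst (σ : ℕ → Path) : Defn → Defn
  | .fld a s => .fld a (s.subst σ)
  | .typ A T => .typ A (T.subst σ)
  | .and d₁ d₂ => .and (d₁.subst σ) (d₂.subst σ)
end

/-- Weakening of a type by one variable. A type over the extended environment is of the form
`T.shift` exactly if the new variable is not free in it. -/
def Typ.shift (T : Typ) : Typ := T.subst fun n => .var (n + 1)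

/-- `T[p/x]` for the most recently bound variable `x`. -/
def Path.inst (r p : Path) : Path := r.subst (single p)

def Typ.inst (T : Typ) (p : Path) : Typ := T.subst (single p)

def Defn.inst (d : Defn) (p : Path) : Defn := d.subst (single p)

/-- A path as a term. -/
abbrev Path.trm (p : Path) : Trm := .stable (.path p)

/-- A value as a term. -/
abbrev Val.trm (v : Val) : Trm := .stable (.val v)

/-! ### Type environments -/

/-- Type environments. The variable `x` has type `Γ[x]`; every entry is read in the scope of the
whole environment, so that `Γ(x) = T` is `Γ[x]? = some T`. -/
abbrev Ctx := List Typ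

/-- The extension `Γ, x : T`. The type `T` lives in the extended scope, since the rules for
objects bind `x` to a type that mentions `x`; when `x` is not to occur, `T` is a `shift`. -/
def Ctx.ext (Γ : Ctx) (T : Typ) : Ctx := T :: Γ.map Typ.shift

/-! ### Path replacement -/

/-- `ReplPath p q r r'`: `r = p.b₁.….bₙ` and `r' = q.b₁.….bₙ` for some `n ≥ 0`. -/
inductive ReplPath (p q : Path) : Path → Path → Prop
  | root : ReplPath p q p q
  | sel {r r' : Path} (a : TrmName) : ReplPath p q r r' → ReplPath p q (.sel r a) (.sel r' a)

/-- `Repl p q T T'`: the type `T'` is `T` with one occurrence of the path `p` (possibly as a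
prefix of a longer path) replaced by `q`. Several occurrences are replaced by several steps. -/
inductive Repl : Path → Path → Typ → Typ → Prop
  | proj {p q r r' : Path} {A : TypName} :
      ReplPath p q r r' → Repl p q (.proj r A) (.proj r' A)
  | sngl {p q r r' : Path} :
      ReplPath p q r r' → Repl p q (.sngl r) (.sngl r')
  | fld {p q : Path} {a : TrmName} {T T' : Typ} :
      Repl p q T T' → Repl p q (.fld a T) (.fld a T')
  | mem₁ {p q : Path} {A : TypName} {S S' T : Typ} :
      Repl p q S S' → Repl p q (.mem A S T) (.mem A S' T)
  | mem₂ {p q : Path} {A : TypName} {S T T' : Typ} :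
      Repl p q T T' → Repl p q (.mem A S T) (.mem A S T')
  | and₁ {p q : Path} {S S' T : Typ} :
      Repl p q S S' → Repl p q (.and S T) (.and S' T)
  | and₂ {p q : Path} {S T T' : Typ} :
      Repl p q T T' → Repl p q (.and S T) (.and S T')
  | mu {p q : Path} {T T' : Typ} :
      Repl p.shift q.shift T T' → Repl p q (.mu T) (.mu T')
  | all₁ {p q : Path} {S S' T : Typ} :
      Repl p q S S' → Repl p q (.all S T) (.all S' T)
  | all₂ {p q : Path} {S T T' : Typ} :
      Repl p.shift q.shift T T' → Repl p q (.all S T) (.all S T')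

/-! ### Unique membership -/

/-- Unique membership with labels, `T ↘ U` with the set `L` of all member labels of `T`. -/
inductive UniqueLabel : Typ → Typ → Set Label → Prop
  | oneTyp (A : TypName) (S T : Typ) :
      UniqueLabel (.mem A S T) (.mem A S T) {Label.typ A}
  | oneFld (a : TrmName) (T : Typ) :
      UniqueLabel (.fld a T) (.fld a T) {Label.trm a}
  | oneRec (T : Typ) :
      UniqueLabel (.mu T) (.mu T) ∅
  | andLeft {U₁ U₂ T₁ T₂ : Typ} {L₁ L₂ : Set Label} :
      UniqueLabel U₁ T₁ L₁ → UniqueLabel U₂ T₂ L₂ → L₁ ∩ L₂ = ∅ →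
      UniqueLabel (.and U₁ U₂) T₁ (L₁ ∪ L₂)
  | andRight {U₁ U₂ T₁ T₂ : Typ} {L₁ L₂ : Set Label} :
      UniqueLabel U₁ T₁ L₁ → UniqueLabel U₂ T₂ L₂ → L₁ ∩ L₂ = ∅ →
      UniqueLabel (.and U₁ U₂) T₂ (L₁ ∪ L₂)

/-- Unique membership `T ↘ U`. -/
inductive UniqueMem : Typ → Typ → Prop
  | label {T U : Typ} {L : Set Label} : UniqueLabel T U L → UniqueMem T U

/-! ### General typing and subtyping -/

/-- All type members of the type have equal bounds. -/
def TightBounds : Typ → Prop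
  | .mem _ U V => U = V
  | .mu U => TightBounds U
  | .fld _ U => TightBounds U
  | .and U V => TightBounds U ∧ TightBounds V
  | _ => True

/-- The labels defined by a definition. -/
def Defn.dom : Defn → Set Label
  | .fld a _ => {Label.trm a}
  | .typ A _ => {Label.typ A}
  | .and d₁ d₂ => d₁.dom ∪ d₂.dom

mutual
/-- Term typing `Γ ⊢ t : T`. A path is typeable if it has some type. -/
inductive Typing : Ctx → Trm → Typ → Prop
  | var {Γ : Ctx} {x : ℕ} {T : Typ} :
      Γ[x]? = some T → Typing Γ (Path.var x).trm T
  | allI {Γ : Ctx} {T U : Typ} {t : Trm} :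
      Typing (Γ.ext T.shift) t U → Typing Γ (Val.lam T t).trm (.all T U)
  | allE {Γ : Ctx} {p q : Path} {S T : Typ} :
      Typing Γ p.trm (.all S T) → Typing Γ q.trm S → Typing Γ (.app p q) (T.inst q)
  | objI {Γ : Ctx} {q : Path} {A : TypName} {T : Typ} {d : Defn} :
      DefTyping (.var 0) (Γ.ext T) d T →
      Typing (Γ.ext T) (Path.var 0).trm (.proj q A) →
      Typing Γ (Val.obj q A T d).trm (.mu T)
  | fldE {Γ : Ctx} {p : Path} {a : TrmName} {T : Typ} :
      Typing Γ p.trm (.fld a T) → Typing Γ (Path.sel p a).trm T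
  | fldI {Γ : Ctx} {p : Path} {a : TrmName} {T : Typ} :
      Typing Γ (Path.sel p a).trm T → Typing Γ p.trm (.fld a T)
  | letIn {Γ : Ctx} {t u : Trm} {T U : Typ} :
      Typing Γ t T → Typing (Γ.ext T.shift) u U.shift → Typing Γ (.letIn t u) U
  | caseOf {Γ : Ctx} {p q : Path} {A : TypName} {t₁ t₂ : Trm} {P Q U : Typ} :
      Typing Γ p.trm P → Typing Γ q.trm Q →
      Typing (Γ.ext (Typ.and (.sngl p) (.proj q A)).shift) t₁ U.shift →
      Typing Γ t₂ U → Typing Γ (.caseOf p q A t₁ t₂) U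
  | snglTrans {Γ : Ctx} {p q : Path} {T : Typ} :
      Typing Γ p.trm (.sngl q) → Typing Γ q.trm T → Typing Γ p.trm T
  | snglSelf {Γ : Ctx} {p : Path} {T : Typ} :
      Typing Γ p.trm T → Typing Γ p.trm (.sngl p)
  | snglE {Γ : Ctx} {p q : Path} {a : TrmName} {T : Typ} :
      Typing Γ p.trm (.sngl q) → Typing Γ (Path.sel q a).trm T →
      Typing Γ (Path.sel p a).trm (.sngl (.sel q a))
  | recI {Γ : Ctx} {p : Path} {T : Typ} :
      Typing Γ p.trm (T.inst p) → Typing Γ p.trm (.mu T)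
  | recE {Γ : Ctx} {p : Path} {T : Typ} :
      Typing Γ p.trm (.mu T) → Typing Γ p.trm (T.inst p)
  | andI {Γ : Ctx} {p : Path} {T U : Typ} :
      Typing Γ p.trm T → Typing Γ p.trm U → Typing Γ p.trm (.and T U)
  | sub {Γ : Ctx} {t : Trm} {T U : Typ} :
      Typing Γ t T → Sub Γ T U → Typing Γ t U
/-- Definition typing `p; Γ ⊢ d : T`, where the path `p` is the identity of the object whose body
is being typed. -/
inductive DefTyping : Path → Ctx → Defn → Typ → Prop
  | typ {p : Path} {Γ : Ctx} {A : TypName} {T : Typ} :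
      DefTyping p Γ (.typ A T) (.mem A T T)
  | all {p : Path} {Γ : Ctx} {a : TrmName} {T U V : Typ} {t : Trm} :
      Typing Γ (Val.lam T t).trm (.all U V) →
      DefTyping p Γ (.fld a (.val (.lam T t))) (.fld a (.all U V))
  | new {p q : Path} {Γ : Ctx} {a : TrmName} {A : TypName} {T : Typ} {d : Defn} :
      DefTyping (.sel p a) Γ (d.inst (.sel p a)) (T.inst (.sel p a)) →
      Typing Γ (Path.sel p a).trm (.proj (q.inst (.sel p a)) A) →
      TightBounds T →
      DefTyping p Γ (.fld a (.val (.obj q A T d))) (.fld a (.mu T))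
  | path {p q : Path} {Γ : Ctx} {a : TrmName} {T : Typ} :
      Typing Γ q.trm T → DefTyping p Γ (.fld a (.path q)) (.fld a (.sngl q))
  | and {p : Path} {Γ : Ctx} {d₁ d₂ : Defn} {T₁ T₂ : Typ} :
      DefTyping p Γ d₁ T₁ → DefTyping p Γ d₂ T₂ → d₁.dom ∩ d₂.dom = ∅ →
      DefTyping p Γ (.and d₁ d₂) (.and T₁ T₂)
/-- Subtyping `Γ ⊢ S <: T`. -/
inductive Sub : Ctx → Typ → Typ → Prop
  | top {Γ : Ctx} {T : Typ} : Sub Γ T .top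
  | bot {Γ : Ctx} {T : Typ} : Sub Γ .bot T
  | refl {Γ : Ctx} {T : Typ} : Sub Γ T T
  | trans {Γ : Ctx} {S T U : Typ} : Sub Γ S T → Sub Γ T U → Sub Γ S U
  | and₁ {Γ : Ctx} {T U : Typ} : Sub Γ (.and T U) T
  | and₂ {Γ : Ctx} {T U : Typ} : Sub Γ (.and T U) U
  | and {Γ : Ctx} {S T U : Typ} : Sub Γ S T → Sub Γ S U → Sub Γ S (.and T U)
  | fld {Γ : Ctx} {a : TrmName} {T U : Typ} :
      Sub Γ T U → Sub Γ (.fld a T) (.fld a U)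
  | fldInv {Γ : Ctx} {a : TrmName} {U T₁ T₂ : Typ} :
      UniqueMem U (.fld a T₁) → Sub Γ U (.fld a T₂) → Sub Γ T₁ T₂
  | mem {Γ : Ctx} {A : TypName} {S₁ S₂ T₁ T₂ : Typ} :
      Sub Γ S₂ S₁ → Sub Γ T₁ T₂ → Sub Γ (.mem A S₁ T₁) (.mem A S₂ T₂)
  | memInv₁ {Γ : Ctx} {A : TypName} {U S₁ S₂ T₁ T₂ : Typ} :
      UniqueMem U (.mem A S₁ T₁) → Sub Γ U (.mem A S₂ T₂) → Sub Γ S₂ S₁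
  | memInv₂ {Γ : Ctx} {A : TypName} {U S₁ S₂ T₁ T₂ : Typ} :
      UniqueMem U (.mem A S₁ T₁) → Sub Γ U (.mem A S₂ T₂) → Sub Γ T₁ T₂
  | subProj {Γ : Ctx} {p : Path} {A : TypName} {S T : Typ} :
      Typing Γ p.trm (.mem A S T) → Sub Γ S (.proj p A)
  | projSub {Γ : Ctx} {p : Path} {A : TypName} {S T : Typ} :
      Typing Γ p.trm (.mem A S T) → Sub Γ (.proj p A) T
  | snglPQ {Γ : Ctx} {p q : Path} {Q T T' : Typ} :
      Typing Γ p.trm (.sngl q) → Typing Γ q.trm Q → Repl p q T T' → Sub Γ T T'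
  | snglQP {Γ : Ctx} {p q : Path} {Q T T' : Typ} :
      Typing Γ p.trm (.sngl q) → Typing Γ q.trm Q → Repl q p T T' → Sub Γ T T'
  | all {Γ : Ctx} {S₁ S₂ T₁ T₂ : Typ} :
      Sub Γ S₂ S₁ → Sub (Γ.ext S₂.shift) T₁ T₂ → Sub Γ (.all S₁ T₁) (.all S₂ T₂)
end

/-! ### Precise typing of paths -/

/-- The level Elim-I, `Γ ⊢! p : T`: the types of a path that are read off the environment by
elimination rules only. -/
inductive Prec₁ (Γ : Ctx) : Path → Typ → Prop
  | var {x : ℕ} {T : Typ} : Γ[x]? = some T → Prec₁ Γ (.var x) T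
  | fld {p : Path} {a : TrmName} {T : Typ} : Prec₁ Γ p (.fld a T) → Prec₁ Γ (.sel p a) T
  | mu {p : Path} {T : Typ} : Prec₁ Γ p (.mu T) → Prec₁ Γ p (T.inst p)
  | and₁ {p : Path} {T U : Typ} : Prec₁ Γ p (.and T U) → Prec₁ Γ p T
  | and₂ {p : Path} {T U : Typ} : Prec₁ Γ p (.and T U) → Prec₁ Γ p U

/-- The level Elim-II, `Γ ⊢!! p : T`: aliasing is propagated through field selection. -/
inductive Prec₂ (Γ : Ctx) : Path → Typ → Prop
  | prec {p : Path} {T : Typ} : Prec₁ Γ p T → Prec₂ Γ p T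
  | snglE {p q : Path} {a : TrmName} {T : Typ} :
      Prec₂ Γ p (.sngl q) → Prec₂ Γ (.sel q a) T → Prec₂ Γ (.sel p a) (.sngl (.sel q a))

/-- The level Elim-III, `Γ ⊢!!! p : T`: a path also has the types of the paths it aliases. -/
inductive Prec₃ (Γ : Ctx) : Path → Typ → Prop
  | prec {p : Path} {T : Typ} : Prec₂ Γ p T → Prec₃ Γ p T
  | snglTrans {p q : Path} {T : Typ} :
      Prec₂ Γ p (.sngl q) → Prec₃ Γ q T → Prec₃ Γ p T

/-! ### Tight subtyping -/

/-- Tight subtyping `Γ ⊢# S <: T`. Only the bodies of function types are compared by general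
subtyping. -/
inductive TightSub (Γ : Ctx) : Typ → Typ → Prop
  | top {T : Typ} : TightSub Γ T .top
  | bot {T : Typ} : TightSub Γ .bot T
  | refl {T : Typ} : TightSub Γ T T
  | trans {S T U : Typ} : TightSub Γ S T → TightSub Γ T U → TightSub Γ S U
  | and₁ {T U : Typ} : TightSub Γ (.and T U) T
  | and₂ {T U : Typ} : TightSub Γ (.and T U) U
  | and {S T U : Typ} : TightSub Γ S T → TightSub Γ S U → TightSub Γ S (.and T U)
  | subProj {p : Path} {A : TypName} {S : Typ} :
      Prec₃ Γ p (.mem A S S) → TightSub Γ S (.proj p A)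
  | projSub {p : Path} {A : TypName} {S : Typ} :
      Prec₃ Γ p (.mem A S S) → TightSub Γ (.proj p A) S
  | snglPQ {p q : Path} {Q T T' : Typ} :
      Prec₃ Γ p (.sngl q) → Prec₂ Γ q Q → Repl p q T T' → TightSub Γ T T'
  | snglQP {p q : Path} {Q T T' : Typ} :
      Prec₃ Γ p (.sngl q) → Prec₂ Γ q Q → Repl q p T T' → TightSub Γ T T'
  | fld {a : TrmName} {T U : Typ} :
      TightSub Γ T U → TightSub Γ (.fld a T) (.fld a U)
  | mem {A : TypName} {S₁ S₂ T₁ T₂ : Typ} :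
      TightSub Γ S₂ S₁ → TightSub Γ T₁ T₂ → TightSub Γ (.mem A S₁ T₁) (.mem A S₂ T₂)
  | all {S₁ S₂ T₁ T₂ : Typ} :
      TightSub Γ S₂ S₁ → Sub (Γ.ext S₂.shift) T₁ T₂ →
      TightSub Γ (.all S₁ T₁) (.all S₂ T₂)

/-! ### Inert environments -/

mutual
/-- Inert types: function types, and recursive types over a record. -/
inductive InertTyp : Typ → Prop
  | all (S T : Typ) : InertTyp (.all S T)
  | mu {T : Typ} {L : Set Label} : RecordTyp T L → InertTyp (.mu T)
/-- Records with set of labels `L`: intersections, with pairwise distinct labels, of type members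
with equal bounds and of fields whose type is inert or a singleton. -/
inductive RecordTyp : Typ → Set Label → Prop
  | mem (A : TypName) (T : Typ) : RecordTyp (.mem A T T) {Label.typ A}
  | fldSngl (a : TrmName) (q : Path) : RecordTyp (.fld a (.sngl q)) {Label.trm a}
  | fld (a : TrmName) {T : Typ} : InertTyp T → RecordTyp (.fld a T) {Label.trm a}
  | and {T U : Typ} {L₁ L₂ : Set Label} :
      RecordTyp T L₁ → RecordTyp U L₂ → L₁ ∩ L₂ = ∅ → RecordTyp (.and T U) (L₁ ∪ L₂)
end

/-- An environment is inert if all its types are inert. -/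
def Inert (Γ : Ctx) : Prop := ∀ T ∈ Γ, InertTyp T

end CDOT

/-!
The obstacle to inverting `Γ ⊢# U <: {a : T}` is transitivity, whose middle type may be anything.
It is removed by `HasDecl Γ U D`, a syntax-directed description of the declarations `D` that `U`
provides: `U` is a declaration with the same label and better bounds, or `⊥`, or an intersection
one of whose sides provides `D`, or a projection `p.A` whose precise definition provides `D`.
The relation is antitone in `U` along tight subtyping (`HasDecl.of_tightSub`), and each declaration
provides itself, so a tight subtype of `D` provides `D`. If moreover `U ↘ D'` for a declaration
`D'` with the label of `D`, disjointness of labels forces `D` to be provided by the conjunct `D'`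
(`HasDecl.of_uniqueLabel`), and reading off the bounds finishes the proof.

Antitonicity has two cases with content, and both use that the environment is inert. For
`S <: p.A`, the definition of `p.A` in precise typing has to be unique (`Prec₃.mem_unique`). For the
replacement of a path by an alias, a projection has to keep its definition
(`Prec₃.replPath_iff`). Both rest on the fact that a path which is an alias at the level `⊢!!` has no
other type there (`Prec₂.eq_sngl`). At the level `⊢!` this holds because every path `p` has
at most one type from which its precise types are derived: a function type, a singleton, or a type
`μ(x : R)`, in which case the other types of `p` are conjuncts of the record `R[p/x]`.
-/

namespace CDOT

/-! ### Conjuncts of records -/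

mutual
theorem InertTyp.subst {T : Typ} (σ : ℕ → Path) : InertTyp T → InertTyp (T.subst σ)
  | .all _ _ => .all _ _
  | .mu h => .mu (h.subst (up σ))
theorem RecordTyp.subst {T : Typ} {L : Set Label} (σ : ℕ → Path) :
    RecordTyp T L → RecordTyp (T.subst σ) L
  | .mem _ _ => .mem _ _
  | .fldSngl _ _ => .fldSngl _ _
  | .fld _ h => .fld _ (h.subst σ)
  | .and h₁ h₂ h => .and (h₁.subst σ) (h₂.subst σ) h
end

/-- `Conjunct D R`: the type `D` is `R` or occurs in `R` below intersections only. -/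
inductive Conjunct (D : Typ) : Typ → Prop
  | refl : Conjunct D D
  | left {R₁ R₂ : Typ} : Conjunct D R₁ → Conjunct D (.and R₁ R₂)
  | right {R₁ R₂ : Typ} : Conjunct D R₂ → Conjunct D (.and R₁ R₂)

theorem Conjunct.trans {D E R : Typ} (h₁ : Conjunct D E) (h₂ : Conjunct E R) : Conjunct D R := by
  induction h₂ with
  | refl => exact h₁
  | left _ ih => exact .left ih
  | right _ ih => exact .right ih

theorem RecordTyp.conjunct {D R : Typ} {L : Set Label} (hR : RecordTyp R L) (h : Conjunct D R) :
    ∃ L', RecordTyp D L' ∧ L' ⊆ L := by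
  induction h generalizing L with
  | refl => exact ⟨L, hR, subset_rfl⟩
  | left _ ih =>
    cases hR with
    | and h₁ _ _ =>
      obtain ⟨L', h, hL⟩ := ih h₁
      exact ⟨L', h, hL.trans Set.subset_union_left⟩
  | right _ ih =>
    cases hR with
    | and _ h₂ _ =>
      obtain ⟨L', h, hL⟩ := ih h₂
      exact ⟨L', h, hL.trans Set.subset_union_right⟩

/-- The label of a declaration; other types have none. -/
def Typ.label? : Typ → Option Label
  | .fld a _ => some (.trm a)
  | .mem A _ _ => some (.typ A)
  | _ => none

theorem RecordTyp.label_mem {D : Typ} {L : Set Label} {l : Label} (h : RecordTyp D L)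
    (hl : D.label? = some l) : l ∈ L := by
  cases h <;> simp_all [Typ.label?]

theorem RecordTyp.conjunct_unique {D D' R : Typ} {L : Set Label} {l : Label} (hR : RecordTyp R L)
    (h : Conjunct D R) (h' : Conjunct D' R) (hl : D.label? = some l) (hl' : D'.label? = some l) :
    D = D' := by
  induction h generalizing L with
  | refl =>
    cases h' with
    | refl => rfl
    | left _ => simp [Typ.label?] at hl
    | right _ => simp [Typ.label?] at hl
  | left h ih =>
    cases hR with
    | and h₁ h₂ hL =>
      cases h' with
      | refl => simp [Typ.label?] at hl'
      | left h' => exact ih h₁ h'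
      | right h' =>
        obtain ⟨_, g, hg⟩ := h₁.conjunct h
        obtain ⟨_, g', hg'⟩ := h₂.conjunct h'
        exact (hL.le ⟨hg (g.label_mem hl), hg' (g'.label_mem hl')⟩).elim
  | right h ih =>
    cases hR with
    | and h₁ h₂ hL =>
      cases h' with
      | refl => simp [Typ.label?] at hl'
      | right h' => exact ih h₂ h'
      | left h' =>
        obtain ⟨_, g, hg⟩ := h₂.conjunct h
        obtain ⟨_, g', hg'⟩ := h₁.conjunct h'
        exact (hL.le ⟨hg' (g'.label_mem hl'), hg (g.label_mem hl)⟩).elim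

/-! ### Precise typing in an inert environment -/

/-- `Root Γ p T`: the type `T` is the one given to the path `p` by its declaration, from which the
other types `Γ ⊢! p : U` arise by opening a recursive type and selecting conjuncts. -/
inductive Root (Γ : Ctx) : Path → Typ → Prop
  | var {x : ℕ} {T : Typ} : Γ[x]? = some T → Root Γ (.var x) T
  | sel {p : Path} {a : TrmName} {R T : Typ} :
      Root Γ p (.mu R) → Conjunct (.fld a T) (R.inst p) → Root Γ (.sel p a) T

variable {Γ : Ctx}

theorem Root.inert_or_sngl (hΓ : Inert Γ) {p : Path} {T : Typ} (h : Root Γ p T) :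
    InertTyp T ∨ ∃ q, T = .sngl q := by
  induction h with
  | var h => exact .inl (hΓ _ (List.mem_of_getElem? h))
  | sel _ hc ih =>
    rcases ih with (_ | hR) | ⟨_, h⟩
    · obtain ⟨_, h, _⟩ := (hR.subst _).conjunct hc
      cases h with
      | fldSngl _ q => exact .inr ⟨q, rfl⟩
      | fld _ h => exact .inl h
    · cases h

theorem Root.record (hΓ : Inert Γ) {p : Path} {R : Typ} (h : Root Γ p (.mu R)) :
    ∃ L, RecordTyp (R.inst p) L := by
  rcases h.inert_or_sngl hΓ with (_ | hR) | ⟨_, h⟩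
  · exact ⟨_, hR.subst _⟩
  · cases h

theorem Root.unique (hΓ : Inert Γ) {p : Path} {T T' : Typ} (h : Root Γ p T) (h' : Root Γ p T') :
    T = T' := by
  induction h generalizing T' with
  | var h =>
    cases h' with
    | var h' => exact Option.some.inj (h.symm.trans h')
  | sel h hc ih =>
    cases h' with
    | sel h' hc' =>
      obtain ⟨_, hR⟩ := h.record hΓ
      cases ih h'
      cases hR.conjunct_unique hc hc' rfl rfl
      rfl

theorem Prec₁.exists_root (hΓ : Inert Γ) {p : Path} {T : Typ} (h : Prec₁ Γ p T) :
    Root Γ p T ∨ ∃ R, Root Γ p (.mu R) ∧ Conjunct T (R.inst p) := by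
  induction h with
  | var h => exact .inl (.var h)
  | fld _ ih =>
    rcases ih with h | ⟨R, h, hc⟩
    · rcases h.inert_or_sngl hΓ with h | ⟨_, h⟩ <;> cases h
    · exact .inl (.sel h hc)
  | mu _ ih =>
    rcases ih with h | ⟨R, h, hc⟩
    · exact .inr ⟨_, h, .refl⟩
    · obtain ⟨_, hR⟩ := h.record hΓ
      obtain ⟨_, h, _⟩ := hR.conjunct hc
      cases h
  | and₁ _ ih =>
    rcases ih with h | ⟨R, h, hc⟩
    · rcases h.inert_or_sngl hΓ with h | ⟨_, h⟩ <;> cases h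
    · exact .inr ⟨R, h, .trans (.left .refl) hc⟩
  | and₂ _ ih =>
    rcases ih with h | ⟨R, h, hc⟩
    · rcases h.inert_or_sngl hΓ with h | ⟨_, h⟩ <;> cases h
    · exact .inr ⟨R, h, .trans (.right .refl) hc⟩

theorem Prec₁.root_of_sngl (hΓ : Inert Γ) {p q : Path} (h : Prec₁ Γ p (.sngl q)) :
    Root Γ p (.sngl q) := by
  rcases h.exists_root hΓ with h | ⟨R, h, hc⟩
  · exact h
  · obtain ⟨_, hR⟩ := h.record hΓ
    obtain ⟨_, h, _⟩ := hR.conjunct hc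
    cases h

theorem Prec₁.eq_sngl (hΓ : Inert Γ) {p q : Path} {T : Typ} (h : Prec₁ Γ p (.sngl q))
    (h' : Prec₁ Γ p T) : T = .sngl q := by
  rcases h'.exists_root hΓ with h' | ⟨R, h', _⟩
  · exact h'.unique hΓ (h.root_of_sngl hΓ)
  · cases h'.unique hΓ (h.root_of_sngl hΓ)

theorem Prec₁.mem_unique (hΓ : Inert Γ) {p : Path} {A : TypName} {S S' T T' : Typ}
    (h : Prec₁ Γ p (.mem A S T)) (h' : Prec₁ Γ p (.mem A S' T')) :
    Typ.mem A S T = .mem A S' T' := by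
  rcases h.exists_root hΓ with h | ⟨R, h, hc⟩
  · rcases h.inert_or_sngl hΓ with h | ⟨_, h⟩ <;> cases h
  rcases h'.exists_root hΓ with h' | ⟨R', h', hc'⟩
  · rcases h'.inert_or_sngl hΓ with h | ⟨_, h⟩ <;> cases h
  obtain ⟨_, hR⟩ := h.record hΓ
  cases h.unique hΓ h'
  exact hR.conjunct_unique hc hc' rfl rfl

theorem Prec₁.of_sel {p : Path} {a : TrmName} {T : Typ} (h : Prec₁ Γ (.sel p a) T) :
    ∃ U, Prec₁ Γ p (.fld a U) := by
  generalize hr : Path.sel p a = r at h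
  induction h with
  | var => cases hr
  | fld h => cases hr; exact ⟨_, h⟩
  | mu _ ih => exact ih hr
  | and₁ _ ih => exact ih hr
  | and₂ _ ih => exact ih hr

theorem Prec₂.of_sel {p : Path} {a : TrmName} {T : Typ} (h : Prec₂ Γ (.sel p a) T) :
    ∃ U, Prec₂ Γ p U := by
  cases h with
  | prec h =>
    obtain ⟨U, h⟩ := h.of_sel
    exact ⟨_, .prec h⟩
  | snglE h _ => exact ⟨_, h⟩

/-- A path that is an alias at the level `⊢!!` has no other type at this level. -/
theorem Prec₂.eq_sngl (hΓ : Inert Γ) {p q : Path} {T : Typ} (h : Prec₂ Γ p (.sngl q))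
    (h' : Prec₂ Γ p T) : T = .sngl q := by
  induction p generalizing q T with
  | var x =>
    cases h with
    | prec h =>
      cases h' with
      | prec h' => exact h.eq_sngl hΓ h'
  | sel p a ih =>
    cases h with
    | prec h =>
      cases h' with
      | prec h' => exact h.eq_sngl hΓ h'
      | snglE h' _ =>
        obtain ⟨U, h⟩ := h.of_sel
        cases ih h' (.prec h)
    | snglE h _ =>
      cases h' with
      | prec h' =>
        obtain ⟨U, h'⟩ := h'.of_sel
        cases ih h (.prec h')
      | snglE h' _ =>
        cases ih h h'
        rfl

theorem Prec₃.mem_unique (hΓ : Inert Γ) {p : Path} {A : TypName} {S S' T T' : Typ}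
    (h : Prec₃ Γ p (.mem A S T)) (h' : Prec₃ Γ p (.mem A S' T')) :
    Typ.mem A S T = .mem A S' T' := by
  generalize hD : Typ.mem A S T = D at h
  induction h with
  | prec h =>
    subst hD
    cases h' with
    | prec h' =>
      cases h with
      | prec h =>
        cases h' with
        | prec h' => exact h.mem_unique hΓ h'
    | snglTrans h' _ => cases h'.eq_sngl hΓ h
  | snglTrans h _ ih =>
    cases h' with
    | prec h' => cases h.eq_sngl hΓ h'
    | snglTrans h' h'' =>
      cases h.eq_sngl hΓ h'
      exact ih h'' hD

/-! ### Replacement of a path by an alias -/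

theorem ReplPath.symm {p q r r' : Path} (h : ReplPath p q r r') : ReplPath q p r' r := by
  induction h with
  | root => exact .root
  | sel a _ ih => exact .sel a ih

theorem Repl.symm {p q : Path} {T T' : Typ} (h : Repl p q T T') : Repl q p T' T := by
  induction h with
  | proj h => exact .proj h.symm
  | sngl h => exact .sngl h.symm
  | fld _ ih => exact .fld ih
  | mem₁ _ ih => exact .mem₁ ih
  | mem₂ _ ih => exact .mem₂ ih
  | and₁ _ ih => exact .and₁ ih
  | and₂ _ ih => exact .and₂ ih
  | mu _ ih => exact .mu ih
  | all₁ _ ih => exact .all₁ ih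
  | all₂ _ ih => exact .all₂ ih

theorem ReplPath.interpolate {p q r r' : Path} (h : ReplPath p q r r') (s : Path) :
    ∃ t, ReplPath p s r t ∧ ReplPath s q t r' := by
  induction h with
  | root => exact ⟨s, .root, .root⟩
  | sel a _ ih =>
    obtain ⟨t, h₁, h₂⟩ := ih
    exact ⟨.sel t a, .sel a h₁, .sel a h₂⟩

/-- Aliasing extends along selections to every path that is typeable on the source side. -/
theorem Prec₂.sngl_of_source (hΓ : Inert Γ) {p q r r' : Path} {T : Typ}
    (h : Prec₂ Γ p (.sngl q)) (hr : ReplPath p q r r') (hT : Prec₂ Γ r T) :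
    Prec₂ Γ r (.sngl r') := by
  induction hr generalizing T with
  | root => exact h
  | sel a _ ih =>
    have hT' := hT
    cases hT with
    | prec hT =>
      obtain ⟨U, hU⟩ := hT.of_sel
      cases (ih (.prec hU)).eq_sngl hΓ (.prec hU)
    | snglE hp _ =>
      cases hp.eq_sngl hΓ (ih hp)
      exact hT'

/-- Aliasing extends along selections to every path that is typeable on the target side. -/
theorem Prec₂.sngl_of_target {p q r r' : Path} {T : Typ}
    (h : Prec₂ Γ p (.sngl q)) (hr : ReplPath p q r r') (hT : Prec₂ Γ r' T) :
    Prec₂ Γ r (.sngl r') := by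
  induction hr generalizing T with
  | root => exact h
  | sel a _ ih =>
    obtain ⟨U, hU⟩ := hT.of_sel
    exact .snglE (ih hU) hT

theorem Prec₃.exists_prec₂ {p : Path} {T : Typ} (h : Prec₃ Γ p T) : ∃ U, Prec₂ Γ p U := by
  cases h with
  | prec h => exact ⟨_, h⟩
  | snglTrans h _ => exact ⟨_, h⟩

theorem Prec₂.replPath_iff (hΓ : Inert Γ) {p q r r' : Path} {A : TypName} {S T : Typ}
    (h : Prec₂ Γ p (.sngl q)) (hr : ReplPath p q r r') :
    Prec₃ Γ r (.mem A S T) ↔ Prec₃ Γ r' (.mem A S T) := by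
  constructor
  · intro hT
    obtain ⟨U, hU⟩ := hT.exists_prec₂
    have hs := h.sngl_of_source hΓ hr hU
    cases hT with
    | prec hT => cases hs.eq_sngl hΓ hT
    | snglTrans hT hT' =>
      cases hs.eq_sngl hΓ hT
      exact hT'
  · intro hT
    obtain ⟨U, hU⟩ := hT.exists_prec₂
    exact .snglTrans (h.sngl_of_target hr hU) hT

/-- Replacing a prefix of a path by an alias preserves the type members of the path. -/
theorem Prec₃.replPath_iff (hΓ : Inert Γ) {p q r r' : Path} {A : TypName} {S T : Typ}
    (h : Prec₃ Γ p (.sngl q)) (hr : ReplPath p q r r') :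
    Prec₃ Γ r (.mem A S T) ↔ Prec₃ Γ r' (.mem A S T) := by
  generalize hV : Typ.sngl q = V at h
  induction h generalizing r with
  | prec h =>
    subst hV
    exact h.replPath_iff hΓ hr
  | @snglTrans _ s _ h _ ih =>
    obtain ⟨t, h₁, h₂⟩ := hr.interpolate s
    exact (h.replPath_iff hΓ h₁).trans (ih h₂ hV)

/-! ### Declarations provided by a type -/

/-- `HasDecl Γ U D`: the type `U` provides the declaration `D`. This is a syntax-directed form of
`Γ ⊢# U <: D` for declarations `D`, without a transitivity rule. -/
inductive HasDecl (Γ : Ctx) : Typ → Typ → Prop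
  | fld {a : TrmName} {T T' : Typ} : TightSub Γ T T' → HasDecl Γ (.fld a T) (.fld a T')
  | mem {A : TypName} {S S' T T' : Typ} :
      TightSub Γ S' S → TightSub Γ T T' → HasDecl Γ (.mem A S T) (.mem A S' T')
  | bot {D : Typ} : HasDecl Γ .bot D
  | and₁ {T U D : Typ} : HasDecl Γ T D → HasDecl Γ (.and T U) D
  | and₂ {T U D : Typ} : HasDecl Γ U D → HasDecl Γ (.and T U) D
  | proj {p : Path} {A : TypName} {S D : Typ} :
      Prec₃ Γ p (.mem A S S) → HasDecl Γ S D → HasDecl Γ (.proj p A) D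

/-- Replacement of `p` by `q` reflects declarations, provided that it preserves the definitions of
projections and that types related by it are tight subtypes of each other. -/
theorem HasDecl.of_repl {p q : Path} {T T' D : Typ} (hr : Repl p q T T')
    (hpath : ∀ {r r' : Path} {A : TypName} {S : Typ}, ReplPath p q r r' →
      Prec₃ Γ r' (.mem A S S) → Prec₃ Γ r (.mem A S S))
    (hsub : ∀ {V V' : Typ}, Repl p q V V' → TightSub Γ V V')
    (hsub' : ∀ {V V' : Typ}, Repl p q V V' → TightSub Γ V' V)
    (h : HasDecl Γ T' D) : HasDecl Γ T D := by
  induction h generalizing T with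
  | fld h =>
    cases hr with
    | fld hr => exact .fld (.trans (hsub hr) h)
  | mem h₁ h₂ =>
    cases hr with
    | mem₁ hr => exact .mem (.trans h₁ (hsub' hr)) h₂
    | mem₂ hr => exact .mem h₁ (.trans (hsub hr) h₂)
  | bot => cases hr
  | and₁ h ih =>
    cases hr with
    | and₁ hr => exact .and₁ (ih hr)
    | and₂ _ => exact .and₁ h
  | and₂ h ih =>
    cases hr with
    | and₁ _ => exact .and₂ h
    | and₂ hr => exact .and₂ (ih hr)
  | proj hp h _ =>
    cases hr with
    | proj hr => exact .proj (hpath hr hp) h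

/-- A tight subtype provides every declaration that its supertype provides. -/
theorem HasDecl.of_tightSub (hΓ : Inert Γ) {S T D : Typ} (hs : TightSub Γ S T)
    (h : HasDecl Γ T D) : HasDecl Γ S D := by
  induction hs generalizing D with
  | top => cases h
  | bot => exact .bot
  | refl => exact h
  | trans _ _ ih₁ ih₂ => exact ih₁ (ih₂ h)
  | and₁ => exact .and₁ h
  | and₂ => exact .and₂ h
  | and _ _ ih₁ ih₂ =>
    cases h with
    | and₁ h => exact ih₁ h
    | and₂ h => exact ih₂ h
  | subProj hp =>
    cases h with
    | proj hp' h =>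
      cases hp.mem_unique hΓ hp'
      exact h
  | projSub hp => exact .proj hp h
  | snglPQ hp hq hr =>
    exact .of_repl hr (fun hr' => (hp.replPath_iff hΓ hr').2) (.snglPQ hp hq)
      (fun hr' => .snglQP hp hq hr'.symm) h
  | snglQP hp hq hr =>
    exact .of_repl hr (fun hr' => (hp.replPath_iff hΓ hr'.symm).1) (.snglQP hp hq)
      (fun hr' => .snglPQ hp hq hr'.symm) h
  | fld hs _ =>
    cases h with
    | fld h => exact .fld (.trans hs h)
  | mem hs₁ hs₂ _ _ =>
    cases h with
    | mem h₁ h₂ => exact .mem (.trans h₁ hs₁) (.trans hs₂ h₂)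
  | all => cases h

/-! ### Inversion along unique membership -/

theorem UniqueLabel.label_mem {U D : Typ} {L : Set Label} {l : Label} (h : UniqueLabel U D L)
    (hl : D.label? = some l) : l ∈ L := by
  induction h with
  | oneTyp => simp_all [Typ.label?]
  | oneFld => simp_all [Typ.label?]
  | oneRec => simp [Typ.label?] at hl
  | andLeft _ _ _ ih _ => exact .inl (ih hl)
  | andRight _ _ _ _ ih => exact .inr (ih hl)

theorem HasDecl.label_mem {U D D' : Typ} {L : Set Label} {l : Label} (h : HasDecl Γ U D)
    (hU : UniqueLabel U D' L) (hl : D.label? = some l) : l ∈ L := by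
  induction hU with
  | oneTyp => cases h; simp_all [Typ.label?]
  | oneFld => cases h; simp_all [Typ.label?]
  | oneRec => cases h
  | andLeft _ _ _ ih₁ ih₂ | andRight _ _ _ ih₁ ih₂ =>
    cases h with
    | and₁ h => exact .inl (ih₁ h)
    | and₂ h => exact .inr (ih₂ h)

/-- A declaration provided by `U` is provided by the unique member of `U` with the same label. -/
theorem HasDecl.of_uniqueLabel {U D D' : Typ} {L : Set Label} {l : Label}
    (hU : UniqueLabel U D' L) (h : HasDecl Γ U D) (hl : D.label? = some l)
    (hl' : D'.label? = some l) : HasDecl Γ D' D := by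
  induction hU with
  | oneTyp | oneFld | oneRec => exact h
  | andLeft h₁ h₂ hL ih _ =>
    cases h with
    | and₁ h => exact ih h hl'
    | and₂ h => exact (hL.le ⟨h₁.label_mem hl', h.label_mem h₂ hl⟩).elim
  | andRight h₁ h₂ hL _ ih =>
    cases h with
    | and₁ h => exact (hL.le ⟨h.label_mem h₁ hl, h₂.label_mem hl'⟩).elim
    | and₂ h => exact ih h hl'

end CDOT

theorem mainTheorem4 (Γ : CDOT.Ctx) (hΓ : CDOT.Inert Γ) (U : CDOT.Typ) :
    (∀ (a : CDOT.TrmName) (T₁ T₂ : CDOT.Typ),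
      CDOT.TightSub Γ U (.fld a T₂) → CDOT.UniqueMem U (.fld a T₁) →
      CDOT.TightSub Γ T₁ T₂) ∧
    (∀ (A : CDOT.TypName) (S₁ T₁ S₂ T₂ : CDOT.Typ),
      CDOT.TightSub Γ U (.mem A S₂ T₂) → CDOT.UniqueMem U (.mem A S₁ T₁) →
      CDOT.TightSub Γ S₂ S₁ ∧ CDOT.TightSub Γ T₁ T₂) := by
  constructor
  · rintro a T₁ T₂ hs ⟨hU⟩
    have h := CDOT.HasDecl.of_tightSub hΓ hs (.fld .refl)
    cases h.of_uniqueLabel hU rfl rfl with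
    | fld h => exact h
  · rintro A S₁ T₁ S₂ T₂ hs ⟨hU⟩
    have h := CDOT.HasDecl.of_tightSub hΓ hs (.mem .refl .refl)
    cases h.of_uniqueLabel hU rfl rfl with
    | mem h₁ h₂ => exact ⟨h₁, h₂⟩
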